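/- **Setting.** Fix $\alpha_{\mathrm{sys}}>0$. For $\alpha>0$ let $V^\alpha$ be the symmetric $2\times2$ game on the choices $\{x,y\}$ with $V^\alpha(x,x)=1+\alpha$, $V^\alpha(y,y)=1$, $V^\alpha(x,y)=V^\alpha(y,x)=0$. For a connected simple graph $G$ on agents $\mathcal N=\{1,\dots,N\}$ and a profile $a\in\{x,y\}^N$ put $U_i^\alpha(a)=\sum_{j\sim i}V^\alpha(a_i,a_j)$ and $W(a)=\sum_i U_i^{\alpha_{\mathrm{sys}}}(a)$. Log-linear learning with action space $\mathcal A=\prod_i\mathcal A_i$, utilities $U_i$ and rationality $\beta>0$ is the Markov chain on $\mathcal A$ in which at each step a uniformly random agent $i$ revises its action to $z\in\mathcal A_i$ with probability proportional to $\exp(\beta U_i(z,a_{-i}))$; the stochastically stable states are the $a\in\mathcal A$ whose probability under the stationary distribution $\pi_\beta$ has a positive limit as $\beta\to\infty$. *Broad attack:* a target set is a partition $S=(S_x,S_y)$ of $\mathcal N$. The utility of $i\in S_y$ is changed to $U_i^\alpha(a)+\mathbf 1(a_i=y)$ and that of $i\in S_x$ to $U_i^\alpha(a)+(1+\alpha)\mathbf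 1(a_i=x)$, with $\mathcal A=\{x,y\}^N$. *Focused attack:* a fixed set is a pair $F=(F_x,F_y)$ of disjoint sets of agents with $\varnothing\neq F_x\cup F_y\subsetneq\mathcal N$; the agents of $F_x$ ($F_y$) have the only action $x$ ($y$), the others have both actions, and the utilities are $U_i^\alpha$. In both cases the risk is $$R(\alpha)=1-\frac{\min W\text{ over the stochastically stable states}}{\max_{a\in\mathcal A}W(a)},$$ denoted $R_{\mathrm b}(\alpha,S;G)$ and $R_{\mathrm f}(\alpha,F;G)$ respectively. Let $R_{\mathrm b}^*(\alpha)$ be the supremum of $R_{\mathrm b}(\alpha,S;G)$ over all $N\ge3$, all connected $G$ on $N$ agents and all target sets $S$, and let $R_{\mathrm f}^*(\alpha)$ be the supremum of $R_{\mathrm f}(\alpha,F;G)$ over all such $N$, $G$ and all fixed sets $F$. For $\boldsymbol\alpha=(\alpha_1,\dots,\alpha_M)$, $M\ge1$, let $A_{\mathrm b}(\boldsymbol\alpha)$ be the $M\times M$ lower triangular matrix with entries $R_{\mathrm b}^*(\alpha_i)$ for $j\le i$ and $0$ for $j>i$, and $A_{\mathrm f}(\boldsymbol\alpha)$ the upper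 triangular matrix with entries $R_{\mathrm f}^*(\alpha_i)$ for $j\ge i$ and $0$ for $j<i$. With $\Delta_M$ the probability simplex and all vector inequalities entrywise, define the linear programming values $$v_{\mathrm b}(\gamma,\boldsymbol\alpha)=\min\{v: p\in\Delta_M,\ v\in[0,1],\ A_{\mathrm b}(\boldsymbol\alpha)p\le v\mathbf 1,\ A_{\mathrm f}(\boldsymbol\alpha)p\le\gamma\mathbf 1\},$$ $$v_{\mathrm f}(\gamma,\boldsymbol\alpha)=\min\{v: p\in\Delta_M,\ v\in[0,1],\ A_{\mathrm f}(\boldsymbol\alpha)p\le v\mathbf 1,\ A_{\mathrm b}(\boldsymbol\alpha)p\le\gamma\mathbf 1\},$$ and the frontier $\mathrm{Par}(\boldsymbol\alpha)=\{(v_{\mathrm f}(\gamma,\boldsymbol\alpha),\gamma):\gamma\in[R_{\mathrm b}^*(\alpha_M),R_{\mathrm b}^*(\alpha_1)]\}$. Finally let $I_k=\left(\frac{k-1}{k},\frac{k}{k+1}\right]$ for $k\ge1$. **Claim.** Let $\alpha_1<\dots<\alpha_M$ with $\alpha_j\in I_{k_j}$ for integers $1\le k_1\le\dots\le k_M$,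 and let $\alpha_j'\in I_{k_j}$ satisfy $\alpha_{\mathrm{sys}}\le\alpha_j'<\alpha_j$ for every $j$. Then: 1. for every $\gamma_{\mathrm b}\in[R_{\mathrm b}^*(\alpha_M),1]$ the minima defining $v_{\mathrm f}(\gamma_{\mathrm b},\boldsymbol\alpha)$ and $v_{\mathrm f}(\gamma_{\mathrm b},\boldsymbol\alpha')$ are attained, and $v_{\mathrm f}(\gamma_{\mathrm b},\boldsymbol\alpha')\le v_{\mathrm f}(\gamma_{\mathrm b},\boldsymbol\alpha)$; 2. for every $\gamma_{\mathrm f}\in[R_{\mathrm f}^*(\alpha_1),1]$ the minima defining $v_{\mathrm b}(\gamma_{\mathrm f},\boldsymbol\alpha)$ and $v_{\mathrm b}(\gamma_{\mathrm f},\boldsymbol\alpha')$ are attained, and $v_{\mathrm b}(\gamma_{\mathrm f},\boldsymbol\alpha')\le v_{\mathrm b}(\gamma_{\mathrm f},\boldsymbol\alpha)$; 3. consequently every point of $\mathrm{Par}(\boldsymbol\alpha)$ is weakly dominated (entrywise $\le$) by a point of $\mathrm{Par}(\boldsymbol\alpha')$. -/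

import Mathlib

noncomputable section

namespace CoordGame

/-- The two conventions available to every agent. -/
inductive Choice where
  | x : Choice
  | y : Choice
  deriving DecidableEq

instance instFintypeChoice : Fintype Choice :=
  ⟨{Choice.x, Choice.y}, by intro c; cases c <;> simp⟩

/-- The payoff of the two-player coordination game with gain `α`: coordinating on `x` pays `1 + α`,
coordinating on `y` pays `1`, and miscoordinating pays `0`. -/
def payoff (α : ℝ) : Choice → Choice → ℝ
  | Choice.x, Choice.x => 1 + α
  | Choice.y, Choice.y => 1
  | _, _ => 0

section Game

variable {V : Type*} [Fintype V] [DecidableEq V]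

open Classical in
/-- The local utility `U_i^α(a)`: the sum of the payoffs of agent `i` against its neighbours in
`G`. With `α` the system gain this is the benefit of agent `i`. -/
def utility (α : ℝ) (G : SimpleGraph V) (i : V) (a : V → Choice) : ℝ :=
  ∑ j with G.Adj i j, payoff α (a i) (a j)

/-- The welfare `W(a)`, the sum of all agent benefits at the system gain `αsys`. -/
def welfare (αsys : ℝ) (G : SimpleGraph V) (a : V → Choice) : ℝ :=
  ∑ i, utility αsys G i a

/-! ### Log-linear learning -/

/-- The probability with which an agent `i` that is selected to revise its choice at the profile `a`
picks the action `z` of its action set `A i`, for rationality `β` and local utilities `U`. -/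
def revisionProb (A : V → Finset Choice) (U : V → (V → Choice) → ℝ) (β : ℝ)
    (i : V) (a : V → Choice) (z : Choice) : ℝ :=
  Real.exp (β * U i (Function.update a i z)) /
    ∑ z' ∈ A i, Real.exp (β * U i (Function.update a i z'))

/-- One-step transition probability from `a` to `b` of log-linear learning: one agent is
selected uniformly at random and revises its action, all others repeat their actions. -/
def transitionProb (A : V → Finset Choice) (U : V → (V → Choice) → ℝ) (β : ℝ)
    (a b : V → Choice) : ℝ :=
  (1 / (Fintype.card V : ℝ)) *
    ∑ i, ∑ z ∈ A i, if b = Function.update a i z then revisionProb A U β i a z else 0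

/-- `μ` is a stationary distribution of log-linear learning on the action space `∏ i, A i`
(viewed as a function on all profiles that vanishes outside of this space). -/
structure IsStationary (A : V → Finset Choice) (U : V → (V → Choice) → ℝ) (β : ℝ)
    (μ : (V → Choice) → ℝ) : Prop where
  nonneg : ∀ a, 0 ≤ μ a
  support : ∀ a, a ∉ Fintype.piFinset A → μ a = 0
  sum_eq_one : ∑ a ∈ Fintype.piFinset A, μ a = 1
  stationary : ∀ b ∈ Fintype.piFinset A,
    ∑ a ∈ Fintype.piFinset A, μ a * transitionProb A U β a b = μ b

/-- The set of stochastically stable states: the profiles `a` of the action space `∏ i, A i` such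
that the stationary probability of `a` has a positive limit as the rationality tends to infinity.
(For nonempty action sets the chain is irreducible, so there is exactly one stationary distribution
for each `β`.) -/
def stochasticallyStable (A : V → Finset Choice) (U : V → (V → Choice) → ℝ) :
    Set (V → Choice) :=
  {a | a ∈ Fintype.piFinset A ∧
    ∃ μ : ℝ → (V → Choice) → ℝ, (∀ β, 0 < β → IsStationary A U β (μ β)) ∧
      ∃ l : ℝ, 0 < l ∧ Filter.Tendsto (fun β => μ β a) Filter.atTop (nhds l)}

/-! ### Broad attacks -/

variable (V) in
/-- A target set of a broad attack: `sx` (`sy`) are the agents with an `x`- (`y`-) imposter. -/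
structure TargetSet where
  sx : Finset V
  sy : Finset V
  disjoint : Disjoint sx sy
  cover : sx ∪ sy = Finset.univ

/-- The perceived utilities under a broad attack. -/
def perceivedUtility (α : ℝ) (G : SimpleGraph V) (S : TargetSet V) (i : V) (a : V → Choice) : ℝ :=
  utility α G i a
    + (if i ∈ S.sy ∧ a i = Choice.y then 1 else 0)
    + (if i ∈ S.sx ∧ a i = Choice.x then 1 + α else 0)

/-- The efficiency `J_b(α, S; G)` under a broad attack. -/
def broadEfficiency (αsys α : ℝ) (G : SimpleGraph V) (S : TargetSet V) : ℝ :=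
  sInf (welfare αsys G '' stochasticallyStable (fun _ => Finset.univ) (perceivedUtility α G S)) /
    sSup (Set.range (welfare αsys G))

/-- The risk `R_b(α, S; G)`. -/
def broadRisk (αsys α : ℝ) (G : SimpleGraph V) (S : TargetSet V) : ℝ :=
  1 - broadEfficiency αsys α G S

/-! ### Focused attacks -/

variable (V) in
/-- A fixed set of a focused attack: the agents of `fx` (`fy`) are forced to play `x` (`y`). At
least one agent is fixed, and the fixed agents form a strict subset of all agents. -/
structure FixedSet where
  fx : Finset V
  fy : Finset V
  disjoint : Disjoint fx fy
  nonempty : (fx ∪ fy).Nonempty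
  strict : fx ∪ fy ⊂ Finset.univ

/-- The restricted action sets `𝒜_i(F)`. -/
def FixedSet.actions (F : FixedSet V) (i : V) : Finset Choice :=
  if i ∈ F.fx then {Choice.x} else if i ∈ F.fy then {Choice.y} else Finset.univ

/-- The efficiency `J_f(α, F; G)` under a focused attack. -/
def focusedEfficiency (αsys α : ℝ) (G : SimpleGraph V) (F : FixedSet V) : ℝ :=
  sInf (welfare αsys G '' stochasticallyStable F.actions (utility α G)) /
    sSup (welfare αsys G '' {a | ∀ i, a i ∈ F.actions i})

/-- The risk `R_f(α, F; G)`. -/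
def focusedRisk (αsys α : ℝ) (G : SimpleGraph V) (F : FixedSet V) : ℝ :=
  1 - focusedEfficiency αsys α G F

end Game

/-! ### Worst-case risks -/

/-- The worst-case broad risk `R_b^*(α)`: the supremum over all connected graphs on `N ≥ 3` agents
and all target sets. -/
def worstBroad (αsys α : ℝ) : ℝ :=
  sSup {r | ∃ (N : ℕ) (G : SimpleGraph (Fin N)) (S : TargetSet (Fin N)),
    3 ≤ N ∧ G.Connected ∧ r = broadRisk αsys α G S}

/-- The worst-case focused risk `R_f^*(α)`: the supremum over all connected graphs on `N ≥ 3`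
agents and all fixed sets. -/
def worstFocused (αsys α : ℝ) : ℝ :=
  sSup {r | ∃ (N : ℕ) (G : SimpleGraph (Fin N)) (F : FixedSet (Fin N)),
    3 ≤ N ∧ G.Connected ∧ r = focusedRisk αsys α G F}

/-- The interval `I_k = ((k-1)/k, k/(k+1)]`. -/
def gainInterval (k : ℕ) : Set ℝ :=
  Set.Ioc (((k : ℝ) - 1) / k) ((k : ℝ) / ((k : ℝ) + 1))

/-! ### The trade-off linear programs for randomized gains -/

section LP

variable {M : ℕ}

/-- The lower triangular matrix `A_b(α)`, whose `i`-th row is `R_b^*(α_i)` at the columns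
`j ≤ i`. -/
def matBroad (αsys : ℝ) (α : Fin M → ℝ) : Matrix (Fin M) (Fin M) ℝ :=
  Matrix.of fun i j => if j ≤ i then worstBroad αsys (α i) else 0

/-- The upper triangular matrix `A_f(α)`, whose `i`-th row is `R_f^*(α_i)` at the columns
`j ≥ i`. -/
def matFocused (αsys : ℝ) (α : Fin M → ℝ) : Matrix (Fin M) (Fin M) ℝ :=
  Matrix.of fun i j => if i ≤ j then worstFocused αsys (α i) else 0

/-- The objective values `v` of the feasible points `(p, v)` of the linear program with constraints
`p ∈ Δ_M`, `v ∈ [0,1]`, and `[A, -1; B, 0] [p; v] ≤ [0; γ 1]`. -/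
def lpValues (A B : Matrix (Fin M) (Fin M) ℝ) (γ : ℝ) : Set ℝ :=
  {v | v ∈ Set.Icc (0 : ℝ) 1 ∧ ∃ p ∈ stdSimplex ℝ (Fin M),
    (Matrix.fromBlocks A (Matrix.of fun _ _ => (-1 : ℝ)) B 0).mulVec
        (Sum.elim p fun _ : Unit => v)
      ≤ Sum.elim (fun _ => 0) (fun _ => γ)}

/-- Feasible values of the program that minimizes the broad risk subject to the level `γf` on the
focused risk. -/
def broadValues (αsys γf : ℝ) (α : Fin M → ℝ) : Set ℝ :=
  lpValues (matBroad αsys α) (matFocused αsys α) γf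

/-- Feasible values of the program that minimizes the focused risk subject to the level `γb` on the
broad risk. -/
def focusedValues (αsys γb : ℝ) (α : Fin M → ℝ) : Set ℝ :=
  lpValues (matFocused αsys α) (matBroad αsys α) γb

/-- The value `v_b(γ_f, α)` of the first program. -/
def vBroad (αsys γf : ℝ) (α : Fin M → ℝ) : ℝ := sInf (broadValues αsys γf α)

/-- The value `v_f(γ_b, α)` of the second program. -/
def vFocused (αsys γb : ℝ) (α : Fin M → ℝ) : ℝ := sInf (focusedValues αsys γb α)

/-- The frontier `Par(α)`: the points `(v_f(γ_b, α), γ_b)` with `γ_b` between the worst-case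
broad risks of the last and of the first gain. -/
def frontier (αsys : ℝ) (α : Fin (M + 1) → ℝ) : Set (ℝ × ℝ) :=
  (fun γb => (vFocused αsys γb α, γb)) ''
    Set.Icc (worstBroad αsys (α (Fin.last M))) (worstBroad αsys (α 0))

end LP

end CoordGame

end

/-! The gain enters the two linear programs only through the worst-case risks. Within one interval
$I_k$ the broad risk is constant, and for gains at least `αsys` the focused risk is nondecreasing.
Passing from `α` to `α'` thus leaves $A_b$ unchanged and lowers $A_f$ entrywise, so every feasible
point stays feasible; the minima exist by compactness (`isLeast_lpValues`, `lpValues_subset`).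

Both risks become computable because log-linear learning in an exact potential game has the Gibbs
measure as its only stationary distribution, so the stable states are the potential maximizers
(`IsPotential.stochasticallyStable_eq`). Here the potential is half the welfare at the perceived
gain, plus the imposter bonuses.

Focused attacks: welfare is affine in the gain, and a larger gain selects maximizers with a larger
slope, which overshoot the system optimum further (`focusedRisk_mono`).

Broad attacks: $R_b^*(\alpha)=1-\frac{k}{(k+1)(1+\alpha_{\mathrm{sys}})}$ on $I_k$
(`worstBroad_eq`). For the upper bound, a connected cluster of `y`-agents with $e$ inner and $c$
boundary edges has at most $e+1$ agents; since switching it to `x` does not pay, integrality gives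
$kc\le e$. A star with $k+1$ leaves attains the bound. -/

namespace CoordGame

/-! ### Stationary distributions and stochastic stability in exact potential games. -/

section LogLinear

variable {V : Type*} [Fintype V] [DecidableEq V]

/-- `Φ` is an exact potential of the utilities `U`. -/
def IsPotential (U : V → (V → Choice) → ℝ) (Φ : (V → Choice) → ℝ) : Prop :=
  ∀ i a z, U i (Function.update a i z) - U i a = Φ (Function.update a i z) - Φ a

omit [Fintype V] in
-- Utility and potential differ by a term that does not depend on the new action, and this factor
-- cancels in the quotient.
theorem IsPotential.revisionProb_eq {A : V → Finset Choice} {U : V → (V → Choice) → ℝ}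
    {Φ : (V → Choice) → ℝ} (h : IsPotential U Φ) (β : ℝ) (i : V) (a : V → Choice) (z : Choice) :
    revisionProb A U β i a z = Real.exp (β * Φ (Function.update a i z)) /
      ∑ z' ∈ A i, Real.exp (β * Φ (Function.update a i z')) := by
  have key : ∀ z, Real.exp (β * U i (Function.update a i z)) =
      Real.exp (β * (U i a - Φ a)) * Real.exp (β * Φ (Function.update a i z)) := by
    intro z
    rw [← Real.exp_add]
    congr 1
    linear_combination β * h i a z
  unfold revisionProb
  simp only [key, ← Finset.mul_sum]
  rw [mul_div_mul_left _ _ (Real.exp_pos _).ne']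

theorem transitionProb_nonneg (A : V → Finset Choice) (U : V → (V → Choice) → ℝ) (β : ℝ)
    (a b : V → Choice) : 0 ≤ transitionProb A U β a b := by
  unfold transitionProb revisionProb
  refine mul_nonneg (by positivity) (Finset.sum_nonneg fun i _ => Finset.sum_nonneg fun z _ => ?_)
  split_ifs
  · positivity
  · exact le_rfl

theorem transitionProb_update_pos [Nonempty V] {A : V → Finset Choice}
    (U : V → (V → Choice) → ℝ) (β : ℝ) (a : V → Choice) (i : V) {z : Choice} (hz : z ∈ A i) :
    0 < transitionProb A U β a (Function.update a i z) := by
  have hnn : ∀ j w, 0 ≤ (if Function.update a i z = Function.update a j w then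
      revisionProb A U β j a w else 0) := by
    intro j w
    unfold revisionProb
    split_ifs
    · positivity
    · exact le_rfl
  unfold transitionProb
  refine mul_pos (by have := Fintype.card_pos (α := V); positivity) ?_
  refine Finset.sum_pos' (fun j _ => Finset.sum_nonneg fun w _ => hnn j w)
    ⟨i, Finset.mem_univ _, Finset.sum_pos' (fun w _ => hnn i w) ⟨z, hz, ?_⟩⟩
  rw [if_pos rfl]
  exact div_pos (Real.exp_pos _) (Finset.sum_pos (fun _ _ => Real.exp_pos _) ⟨z, hz⟩)

theorem sum_transitionProb [Nonempty V] {A : V → Finset Choice} (hA : ∀ i, (A i).Nonempty)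
    (U : V → (V → Choice) → ℝ) (β : ℝ) {a : V → Choice} (ha : a ∈ Fintype.piFinset A) :
    ∑ b ∈ Fintype.piFinset A, transitionProb A U β a b = 1 := by
  unfold transitionProb
  rw [← Finset.mul_sum, Finset.sum_comm]
  have : ∀ i ∈ Finset.univ, ∑ b ∈ Fintype.piFinset A, ∑ z ∈ A i,
      (if b = Function.update a i z then revisionProb A U β i a z else 0) = 1 := by
    intro i _
    rw [Finset.sum_comm]
    have h1 : ∀ z ∈ A i, ∑ b ∈ Fintype.piFinset A,
        (if b = Function.update a i z then revisionProb A U β i a z else 0) =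
        revisionProb A U β i a z := by
      intro z hz
      rw [Finset.sum_ite_eq' _ _ (fun _ => revisionProb A U β i a z), if_pos]
      rw [Fintype.mem_piFinset] at ha ⊢
      intro j
      rcases eq_or_ne j i with rfl | hj
      · simpa using hz
      · simpa [hj] using ha j
    rw [Finset.sum_congr rfl h1]
    unfold revisionProb
    rw [← Finset.sum_div]
    exact div_self (Finset.sum_pos (fun _ _ => Real.exp_pos _) (hA i)).ne'
  rw [Finset.sum_congr rfl this]
  have := Fintype.card_pos (α := V)
  simp only [Finset.sum_const, Finset.card_univ, nsmul_eq_mul, mul_one]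
  field_simp

theorem IsPotential.detailed_balance {A : V → Finset Choice} {U : V → (V → Choice) → ℝ}
    {Φ : (V → Choice) → ℝ} (h : IsPotential U Φ) (β : ℝ) {a b : V → Choice}
    (ha : a ∈ Fintype.piFinset A) (hb : b ∈ Fintype.piFinset A) :
    Real.exp (β * Φ a) * transitionProb A U β a b =
      Real.exp (β * Φ b) * transitionProb A U β b a := by
  -- If agent `i` revises and the result is `b`, the action picked can only be `b i`.
  have key : ∀ (a b : V → Choice) (i : V), b ∈ Fintype.piFinset A →
      ∑ z ∈ A i, (if b = Function.update a i z then revisionProb A U β i a z else 0) =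
      if b = Function.update a i (b i) then revisionProb A U β i a (b i) else 0 := by
    intro a b i hb
    rw [Finset.sum_eq_single (b i)]
    · intro z _ hz
      rw [if_neg]
      intro hbz
      exact hz (by rw [hbz]; simp)
    · intro hbi
      exact absurd (Fintype.mem_piFinset.1 hb i) hbi
  unfold transitionProb
  rw [mul_left_comm, mul_left_comm (Real.exp (β * Φ b)), Finset.mul_sum _ _ (Real.exp (β * Φ a)),
    Finset.mul_sum _ _ (Real.exp (β * Φ b))]
  congr 1
  refine Finset.sum_congr rfl fun i _ => ?_
  rw [key a b i hb, key b a i ha]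
  by_cases hab : b = Function.update a i (b i)
  · have hba : a = Function.update b i (a i) := by
      rw [hab]; simp
    have hupd : ∀ z, Function.update a i z = Function.update b i z := by
      intro z
      rw [hab]; simp
    rw [if_pos hab, if_pos hba, h.revisionProb_eq, h.revisionProb_eq, ← hab, ← hba]
    simp only [hupd]
    ring
  · have hba : ¬ a = Function.update b i (a i) := by
      intro hba
      apply hab
      rw [hba]; simp
    rw [if_neg hab, if_neg hba]
    ring

/-- The Gibbs distribution of the potential `Φ` on the action space `∏ i, A i`. -/
noncomputable def gibbs (A : V → Finset Choice) (Φ : (V → Choice) → ℝ) (β : ℝ)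
    (a : V → Choice) : ℝ :=
  if a ∈ Fintype.piFinset A then
    Real.exp (β * Φ a) / ∑ b ∈ Fintype.piFinset A, Real.exp (β * Φ b)
  else 0

theorem sum_exp_pos {A : V → Finset Choice} (hA : ∀ i, (A i).Nonempty)
    (Φ : (V → Choice) → ℝ) (β : ℝ) : 0 < ∑ b ∈ Fintype.piFinset A, Real.exp (β * Φ b) :=
  Finset.sum_pos (fun _ _ => Real.exp_pos _) (Fintype.piFinset_nonempty.2 hA)

theorem IsPotential.isStationary_gibbs [Nonempty V] {A : V → Finset Choice}
    (hA : ∀ i, (A i).Nonempty) {U : V → (V → Choice) → ℝ}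
    {Φ : (V → Choice) → ℝ} (h : IsPotential U Φ) (β : ℝ) :
    IsStationary A U β (gibbs A Φ β) := by
  have hZ := sum_exp_pos hA Φ β
  refine ⟨fun a => ?_, fun a ha => if_neg ha, ?_, fun b hb => ?_⟩
  · unfold gibbs
    split_ifs
    · positivity
    · exact le_rfl
  · unfold gibbs
    rw [Finset.sum_congr rfl fun a ha => if_pos ha, ← Finset.sum_div]
    exact div_self hZ.ne'
  · have : ∀ a ∈ Fintype.piFinset A, gibbs A Φ β a * transitionProb A U β a b =
        gibbs A Φ β b * transitionProb A U β b a := by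
      intro a ha
      unfold gibbs
      rw [if_pos ha, if_pos hb, div_mul_eq_mul_div, h.detailed_balance β ha hb]
      ring
    rw [Finset.sum_congr rfl this, ← Finset.mul_sum, sum_transitionProb hA U β hb, mul_one]

/-- Maximum principle: by detailed balance the density `r` of `μ` against the Gibbs weights is
harmonic for the chain. Where `r` is maximal, all profiles reachable by one revision share that
value, so `r` is constant on the action space. -/
theorem IsPotential.eq_gibbs [Nonempty V] {A : V → Finset Choice}
    (hA : ∀ i, (A i).Nonempty) {U : V → (V → Choice) → ℝ}
    {Φ : (V → Choice) → ℝ} (h : IsPotential U Φ) {β : ℝ} {μ : (V → Choice) → ℝ}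
    (hμ : IsStationary A U β μ) : μ = gibbs A Φ β := by
  set r : (V → Choice) → ℝ := fun a => μ a / Real.exp (β * Φ a) with hr
  have hμr : ∀ a, μ a = r a * Real.exp (β * Φ a) := fun a =>
    (div_mul_cancel₀ _ (Real.exp_pos _).ne').symm
  have harm : ∀ b ∈ Fintype.piFinset A,
      ∑ a ∈ Fintype.piFinset A, transitionProb A U β b a * r a = r b := by
    intro b hb
    have h1 := hμ.stationary b hb
    have h2 : ∀ a ∈ Fintype.piFinset A, μ a * transitionProb A U β a b =
        (transitionProb A U β b a * r a) * Real.exp (β * Φ b) := by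
      intro a ha
      rw [hμr, mul_assoc, h.detailed_balance β ha hb]
      ring
    rw [Finset.sum_congr rfl h2, ← Finset.sum_mul, hμr b] at h1
    exact mul_right_cancel₀ (Real.exp_pos _).ne' h1
  obtain ⟨m, hm, hmax⟩ := Finset.exists_max_image _ r (Fintype.piFinset_nonempty.2 hA)
  have step : ∀ b ∈ Fintype.piFinset A, r b = r m → ∀ i, ∀ z ∈ A i,
      r (Function.update b i z) = r m := by
    intro b hb hbm i z hz
    have hmem : Function.update b i z ∈ Fintype.piFinset A := by
      rw [Fintype.mem_piFinset] at hb ⊢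
      intro j
      rcases eq_or_ne j i with rfl | hj
      · simpa using hz
      · simpa [hj] using hb j
    have h0 : ∑ a ∈ Fintype.piFinset A, transitionProb A U β b a * (r m - r a) = 0 := by
      simp only [mul_sub, Finset.sum_sub_distrib]
      rw [harm b hb, ← Finset.sum_mul, sum_transitionProb hA U β hb, hbm]
      ring
    rw [Finset.sum_eq_zero_iff_of_nonneg fun a ha =>
      mul_nonneg (transitionProb_nonneg A U β b a) (sub_nonneg.2 (hmax a ha))] at h0
    rcases mul_eq_zero.1 (h0 _ hmem) with h3 | h3
    · exact absurd h3 (transitionProb_update_pos U β b i hz).ne'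
    · linarith
  have hconst : ∀ c ∈ Fintype.piFinset A, r c = r m := by
    intro c hc
    have hc' := Fintype.mem_piFinset.1 hc
    have hm' := Fintype.mem_piFinset.1 hm
    -- Walk from `m` to `c` by changing one agent at a time; every intermediate profile stays in the
    -- action space.
    have : ∀ s : Finset V, r (s.piecewise c m) = r m := by
      intro s
      induction s using Finset.induction_on with
      | empty => simp
      | insert i s _ ih =>
        rw [Finset.piecewise_insert]
        refine step _ ?_ ih i _ (hc' i)
        rw [Fintype.mem_piFinset]
        intro j
        by_cases hj : j ∈ s
        · simpa [hj] using hc' j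
        · simpa [hj] using hm' j
    simpa using this Finset.univ
  have hsum : r m * ∑ b ∈ Fintype.piFinset A, Real.exp (β * Φ b) = 1 := by
    rw [← hμ.sum_eq_one, Finset.mul_sum]
    exact Finset.sum_congr rfl fun a ha => by rw [hμr, hconst a ha]
  funext a
  unfold gibbs
  split_ifs with ha
  · rw [hμr, hconst a ha, eq_div_iff (sum_exp_pos hA Φ β).ne']
    linear_combination Real.exp (β * Φ a) * hsum
  · exact hμ.support a ha

/-- The inverse of the Gibbs weight at a maximizer tends to the number of maximizers. -/
theorem tendsto_gibbs {A : V → Finset Choice} {Φ : (V → Choice) → ℝ} {a : V → Choice}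
    (ha : a ∈ Fintype.piFinset A) (hmax : ∀ b ∈ Fintype.piFinset A, Φ b ≤ Φ a) :
    ∃ l : ℝ, 0 < l ∧ Filter.Tendsto (fun β => gibbs A Φ β a) Filter.atTop (nhds l) := by
  classical
  have h1 : ∀ b ∈ Fintype.piFinset A, Filter.Tendsto
      (fun β : ℝ => Real.exp (β * (Φ b - Φ a))) Filter.atTop
      (nhds (if Φ b = Φ a then 1 else 0)) := by
    intro b hb
    split_ifs with hba
    · simp [hba]
    · exact Real.tendsto_exp_atBot.comp
        (Filter.tendsto_id.atTop_mul_const_of_neg (sub_neg.2 (lt_of_le_of_ne (hmax b hb) hba)))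
  have h2 := tendsto_finsetSum _ h1
  have hpos : (0 : ℝ) < ∑ b ∈ Fintype.piFinset A, if Φ b = Φ a then 1 else 0 :=
    Finset.sum_pos' (fun b _ => by split_ifs <;> norm_num) ⟨a, ha, by simp⟩
  refine ⟨_, inv_pos.2 hpos, (h2.inv₀ hpos.ne').congr fun β => ?_⟩
  unfold gibbs
  rw [if_pos ha, ← inv_div, Finset.sum_div]
  simp only [← Real.exp_sub, ← mul_sub]

theorem tendsto_gibbs_zero {A : V → Finset Choice} {Φ : (V → Choice) → ℝ} {a b : V → Choice}
    (hb : b ∈ Fintype.piFinset A) (hab : Φ a < Φ b) :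
    Filter.Tendsto (fun β => gibbs A Φ β a) Filter.atTop (nhds 0) := by
  have h1 : Filter.Tendsto (fun β : ℝ => Real.exp (β * (Φ a - Φ b))) Filter.atTop (nhds 0) :=
    Real.tendsto_exp_atBot.comp (Filter.tendsto_id.atTop_mul_const_of_neg (sub_neg.2 hab))
  refine squeeze_zero (fun β => ?_) (fun β => ?_) h1
  · unfold gibbs
    split_ifs
    · positivity
    · exact le_rfl
  · unfold gibbs
    split_ifs
    · rw [mul_sub, Real.exp_sub]
      exact div_le_div_of_nonneg_left (Real.exp_pos _).le (Real.exp_pos _)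
        (Finset.single_le_sum (f := fun b => Real.exp (β * Φ b))
          (fun _ _ => (Real.exp_pos _).le) hb)
    · exact (Real.exp_pos _).le

/-- For exact potential games the stochastically stable states are the potential maximizers. -/
theorem IsPotential.stochasticallyStable_eq [Nonempty V] {A : V → Finset Choice}
    (hA : ∀ i, (A i).Nonempty) {U : V → (V → Choice) → ℝ}
    {Φ : (V → Choice) → ℝ} (h : IsPotential U Φ) :
    stochasticallyStable A U =
      {a | a ∈ Fintype.piFinset A ∧ ∀ b ∈ Fintype.piFinset A, Φ b ≤ Φ a} := by
  ext a
  refine and_congr_right fun ha => ⟨?_, fun hmax => ?_⟩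
  · rintro ⟨μ, hμ, l, hl, hlim⟩ b hb
    by_contra! hlt
    have h0 := tendsto_gibbs_zero hb hlt
    have heq : (fun β => μ β a) =ᶠ[Filter.atTop] fun β => gibbs A Φ β a := by
      filter_upwards [Filter.eventually_gt_atTop 0] with β hβ
      rw [h.eq_gibbs hA (hμ β hβ)]
    exact hl.ne' (tendsto_nhds_unique hlim (h0.congr' heq.symm))
  · exact ⟨gibbs A Φ, fun β _ => h.isStationary_gibbs hA β, tendsto_gibbs ha hmax⟩

theorem IsPotential.stochasticallyStable_nonempty [Nonempty V] {A : V → Finset Choice}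
    (hA : ∀ i, (A i).Nonempty) {U : V → (V → Choice) → ℝ}
    {Φ : (V → Choice) → ℝ} (h : IsPotential U Φ) : (stochasticallyStable A U).Nonempty := by
  rw [h.stochasticallyStable_eq hA]
  exact Finset.exists_max_image _ Φ (Fintype.piFinset_nonempty.2 hA)

end LogLinear

/-! ### Potential of the coordination game. -/

section Potential

variable {V : Type*} [Fintype V] [DecidableEq V]

theorem payoff_comm (α : ℝ) (c d : Choice) : payoff α c d = payoff α d c := by
  cases c <;> cases d <;> rfl

omit [DecidableEq V] in
open Classical in
theorem utility_eq_sum_ite (α : ℝ) (G : SimpleGraph V) (i : V) (a : V → Choice) :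
    utility α G i a = ∑ j, if G.Adj i j then payoff α (a i) (a j) else 0 := by
  unfold utility
  rw [Finset.sum_filter]

open Classical in
-- Every edge at `i` is counted from both ends, and the remaining sum does not involve `a i`. Hence
-- half the welfare is a potential.
theorem welfare_eq_two_mul_utility_add (α : ℝ) (G : SimpleGraph V) (i : V) (a : V → Choice) :
    welfare α G a = 2 * utility α G i a + ∑ p ∈ Finset.univ.erase i, ∑ q ∈ Finset.univ.erase i,
      if G.Adj p q then payoff α (a p) (a q) else 0 := by
  unfold welfare
  rw [← Finset.add_sum_erase _ _ (Finset.mem_univ i)]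
  have h1 : ∀ p ∈ Finset.univ.erase i, utility α G p a =
      (if G.Adj i p then payoff α (a i) (a p) else 0) +
        ∑ q ∈ Finset.univ.erase i, if G.Adj p q then payoff α (a p) (a q) else 0 := by
    intro p _
    rw [utility_eq_sum_ite, ← Finset.add_sum_erase _ _ (Finset.mem_univ i), G.adj_comm,
      payoff_comm]
  have h2 : ∑ p ∈ Finset.univ.erase i, (if G.Adj i p then payoff α (a i) (a p) else 0) =
      utility α G i a := by
    rw [utility_eq_sum_ite, ← Finset.add_sum_erase _ _ (Finset.mem_univ i)]
    simp
  rw [Finset.sum_congr rfl h1, Finset.sum_add_distrib, h2]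
  ring

/-- Coordination on a graph with individual bonuses `h` is an exact potential game. -/
theorem isPotential_utility_add (α : ℝ) (G : SimpleGraph V) (h : V → Choice → ℝ) :
    IsPotential (fun i a => utility α G i a + h i (a i))
      (fun a => welfare α G a / 2 + ∑ i, h i (a i)) := by
  classical
  intro i a z
  have hrest : ∀ p ∈ Finset.univ.erase i, Function.update a i z p = a p := fun p hp =>
    Function.update_of_ne (Finset.ne_of_mem_erase hp) _ _
  have h1 : ∑ p ∈ Finset.univ.erase i, ∑ q ∈ Finset.univ.erase i,
      (if G.Adj p q then payoff α (Function.update a i z p) (Function.update a i z q) else 0) =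
      ∑ p ∈ Finset.univ.erase i, ∑ q ∈ Finset.univ.erase i,
      if G.Adj p q then payoff α (a p) (a q) else 0 :=
    Finset.sum_congr rfl fun p hp => Finset.sum_congr rfl fun q hq => by
      rw [hrest p hp, hrest q hq]
  have h2 : ∑ p ∈ Finset.univ.erase i, h p (Function.update a i z p) =
      ∑ p ∈ Finset.univ.erase i, h p (a p) :=
    Finset.sum_congr rfl fun p hp => by rw [hrest p hp]
  simp only [welfare_eq_two_mul_utility_add α G i, h1,
    ← Finset.add_sum_erase _ _ (Finset.mem_univ i), h2]
  ring

theorem isPotential_utility (α : ℝ) (G : SimpleGraph V) :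
    IsPotential (utility α G) (fun a => welfare α G a / 2) := by
  simpa using isPotential_utility_add α G fun _ _ => 0

omit [DecidableEq V] in
theorem welfare_nonneg {α : ℝ} (hα : -1 ≤ α) (G : SimpleGraph V) (a : V → Choice) :
    0 ≤ welfare α G a := by
  refine Finset.sum_nonneg fun i _ => Finset.sum_nonneg fun j _ => ?_
  cases a i <;> cases a j <;> simp only [payoff] <;> linarith

omit [DecidableEq V] in
open Classical in
/-- The welfare is affine in the gain; its slope counts the ordered pairs coordinated on `x`. -/
theorem exists_welfare_eq (G : SimpleGraph V) (a : V → Choice) :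
    ∃ p q : ℝ, ∀ α, welfare α G a = (1 + α) * p + q := by
  refine ⟨∑ i, ∑ j with G.Adj i j, if a i = Choice.x ∧ a j = Choice.x then 1 else 0,
    ∑ i, ∑ j with G.Adj i j, if a i = Choice.y ∧ a j = Choice.y then 1 else 0, fun α => ?_⟩
  unfold welfare utility
  simp only [Finset.mul_sum, ← Finset.sum_add_distrib]
  refine Finset.sum_congr rfl fun i _ => Finset.sum_congr rfl fun j _ => ?_
  cases a i <;> cases a j <;> simp [payoff]

end Potential

/-! ### Focused attacks: monotonicity in the gain. -/

section Focused

variable {V : Type*} [Fintype V] [DecidableEq V]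

theorem div_le_one_of_sInf_sSup {s t : Set ℝ} (hs : s.Finite) (ht : BddAbove t) (hst : s ⊆ t)
    (ht0 : ∀ w ∈ t, 0 ≤ w) : 0 ≤ sInf s / sSup t ∧ sInf s / sSup t ≤ 1 := by
  have hT : 0 ≤ sSup t := Real.sSup_nonneg ht0
  refine ⟨div_nonneg (Real.sInf_nonneg fun w hw => ht0 w (hst hw)) hT, ?_⟩
  refine div_le_one_of_le₀ ?_ hT
  -- For empty `s` the convention `sInf ∅ = 0` keeps the bound true.
  rcases s.eq_empty_or_nonempty with rfl | hne
  · simpa using hT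
  · obtain ⟨w, hw⟩ := hne
    exact (csInf_le hs.bddBelow hw).trans (le_csSup ht (hst hw))

theorem FixedSet.actions_nonempty (F : FixedSet V) (i : V) : (F.actions i).Nonempty := by
  unfold FixedSet.actions
  split_ifs
  · simp
  · simp
  · exact ⟨Choice.x, Finset.mem_univ _⟩

theorem focusedRisk_mem_Icc {αsys : ℝ} (hsys : 0 < αsys) (α : ℝ) (G : SimpleGraph V)
    (F : FixedSet V) : focusedRisk αsys α G F ∈ Set.Icc 0 1 := by
  have h := div_le_one_of_sInf_sSup
    (s := welfare αsys G '' stochasticallyStable F.actions (utility α G))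
    (t := welfare αsys G '' {a | ∀ i, a i ∈ F.actions i})
    (Set.toFinite _) (Set.toFinite _).bddAbove
    (Set.image_mono fun a ha => Fintype.mem_piFinset.1 ha.1)
    (by rintro _ ⟨a, -, rfl⟩; exact welfare_nonneg (by linarith) G a)
  unfold focusedRisk focusedEfficiency
  exact ⟨by linarith [h.2], by linarith [h.1]⟩

/-- For gains above the system gain, a smaller gain is safer against each focused attack. -/
theorem focusedRisk_mono [Nonempty V] {αsys α α' : ℝ} (hsys : 0 < αsys) (hge : αsys ≤ α')
    (hlt : α' < α) (G : SimpleGraph V) (F : FixedSet V) :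
    focusedRisk αsys α' G F ≤ focusedRisk αsys α G F := by
  have hst := fun α => (isPotential_utility α G).stochasticallyStable_eq F.actions_nonempty
  have hne := fun α => (isPotential_utility α G).stochasticallyStable_nonempty F.actions_nonempty
  unfold focusedRisk focusedEfficiency
  refine sub_le_sub_left (div_le_div_of_nonneg_right ?_ (Real.sSup_nonneg ?_)) _
  · obtain ⟨a, ha⟩ := hne α
    refine le_csInf ((hne α').image _) ?_
    rintro _ ⟨a', ha', rfl⟩
    refine (csInf_le (Set.toFinite _).bddBelow (Set.mem_image_of_mem _ ha)).trans ?_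
    rw [hst] at ha ha'
    have h1 := ha.2 a' ha'.1
    have h2 := ha'.2 a ha.1
    obtain ⟨p, q, hw⟩ := exists_welfare_eq G a
    obtain ⟨p', q', hw'⟩ := exists_welfare_eq G a'
    simp only [hw, hw'] at h1 h2 ⊢
    -- Adding the two optimality inequalities gives $(\alpha-\alpha')(p-p')\ge0$. The goal then
    -- follows from `h2` by subtracting $(\alpha'-\alpha_{\mathrm{sys}})(p-p')\ge0$.
    have h3 : p' ≤ p := by nlinarith
    nlinarith
  · rintro _ ⟨a, -, rfl⟩
    exact welfare_nonneg (by linarith) G a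

end Focused

/-! ### Edge counts between sets of agents. -/

section Pairs

variable {V : Type*} [DecidableEq V]

open Classical in
/-- The number of ordered adjacent pairs in `A × B`. -/
noncomputable def pairs (G : SimpleGraph V) (A B : Finset V) : ℝ :=
  ∑ i ∈ A, ∑ j ∈ B, if G.Adj i j then 1 else 0

omit [DecidableEq V] in
theorem pairs_comm (G : SimpleGraph V) (A B : Finset V) : pairs G A B = pairs G B A := by
  unfold pairs
  rw [Finset.sum_comm]
  exact Finset.sum_congr rfl fun i _ => Finset.sum_congr rfl fun j _ => by
    rw [G.adj_comm]

theorem pairs_union_left (G : SimpleGraph V) {A A' : Finset V} (h : Disjoint A A')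
    (B : Finset V) : pairs G (A ∪ A') B = pairs G A B + pairs G A' B :=
  Finset.sum_union h

theorem pairs_union_right (G : SimpleGraph V) (A : Finset V) {B B' : Finset V}
    (h : Disjoint B B') : pairs G A (B ∪ B') = pairs G A B + pairs G A B' := by
  rw [pairs_comm, pairs_union_left G h, pairs_comm G B, pairs_comm G B']

omit [DecidableEq V] in
theorem pairs_nonneg (G : SimpleGraph V) (A B : Finset V) : 0 ≤ pairs G A B :=
  Finset.sum_nonneg fun _ _ => Finset.sum_nonneg fun _ _ => by split_ifs <;> norm_num

omit [DecidableEq V] in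
theorem pairs_eq_zero (G : SimpleGraph V) {A B : Finset V}
    (h : ∀ i ∈ A, ∀ j ∈ B, ¬ G.Adj i j) : pairs G A B = 0 :=
  Finset.sum_eq_zero fun i hi => Finset.sum_eq_zero fun j hj => if_neg (h i hi j hj)

omit [DecidableEq V] in
theorem exists_pairs_eq_natCast (G : SimpleGraph V) (A B : Finset V) :
    ∃ n : ℕ, pairs G A B = n := by
  classical
  exact ⟨∑ i ∈ A, ∑ j ∈ B, if G.Adj i j then 1 else 0, by unfold pairs; push_cast; rfl⟩

omit [DecidableEq V] in
/-- A connected set `C` spans at least `|C| - 1` edges. -/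
theorem exists_pairs_self_eq (G : SimpleGraph V) (C : Finset V)
    (hC : (G.induce (C : Set V)).Connected) :
    ∃ e : ℕ, pairs G C C = 2 * e ∧ C.card ≤ e + 1 := by
  classical
  refine ⟨(G.induce (C : Set V)).edgeFinset.card, ?_, ?_⟩
  · have h := (G.induce (C : Set V)).sum_degrees_eq_twice_card_edges
    have h' : ((∑ v, (G.induce (C : Set V)).degree v : ℕ) : ℝ) = pairs G C C := by
      unfold pairs
      rw [← Finset.sum_coe_sort C]
      push_cast
      refine Finset.sum_congr rfl fun v _ => ?_
      rw [← Finset.sum_coe_sort C, ← SimpleGraph.card_neighborFinset_eq_degree,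
        SimpleGraph.neighborFinset_eq_filter, Finset.card_filter]
      push_cast
      rfl
    rw [← h', h]
    push_cast
    rfl
  · have h := hC.card_vert_le_card_edgeSet_add_one
    rw [Nat.card_eq_fintype_card, Nat.card_eq_fintype_card, ← SimpleGraph.edgeFinset_card] at h
    simpa using h

variable [Fintype V]

omit [DecidableEq V] in
theorem welfare_eq_pairs (α : ℝ) (G : SimpleGraph V) (a : V → Choice) :
    welfare α G a = (1 + α) * pairs G {i | a i = Choice.x} {i | a i = Choice.x} +
      pairs G {i | a i = Choice.y} {i | a i = Choice.y} := by
  classical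
  unfold welfare pairs
  simp only [utility_eq_sum_ite, Finset.mul_sum, Finset.sum_filter]
  rw [← Finset.sum_add_distrib]
  refine Finset.sum_congr rfl fun i _ => ?_
  cases hi : a i
  · simp only [if_true, reduceCtorEq, if_false, add_zero, Finset.mul_sum]
    refine Finset.sum_congr rfl fun j _ => ?_
    cases hj : a j <;> simp [payoff]
  · simp only [if_true, reduceCtorEq, if_false, zero_add, mul_zero]
    refine Finset.sum_congr rfl fun j _ => ?_
    cases hj : a j <;> simp [payoff]

/-- The welfare change when a set `C` of `y`-agents without `y`-neighbours outside of `C` switches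
to `x`. -/
theorem welfare_piecewise (α : ℝ) (G : SimpleGraph V) (a : V → Choice) {C : Finset V}
    (hC : ∀ i ∈ C, a i = Choice.y) (hclosed : ∀ i ∈ C, ∀ j, a j = Choice.y → G.Adj i j → j ∈ C) :
    welfare α G (C.piecewise (fun _ => Choice.x) a) =
      welfare α G a + 2 * (1 + α) * pairs G C {i | a i = Choice.x} + α * pairs G C C := by
  set X : Finset V := {i | a i = Choice.x} with hX
  set Y : Finset V := {i | a i = Choice.y} with hY
  have hX' : ({i | C.piecewise (fun _ => Choice.x) a i = Choice.x} : Finset V) = X ∪ C := by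
    ext i
    by_cases hi : i ∈ C <;> simp [hX, hi]
  have hY' : ({i | C.piecewise (fun _ => Choice.x) a i = Choice.y} : Finset V) = Y \ C := by
    ext i
    by_cases hi : i ∈ C <;> simp [hY, hi]
  have hXC : Disjoint X C := by
    rw [Finset.disjoint_left]
    intro i hi hi'
    have := hC i hi'
    simp [hX, this] at hi
  have hCY : C ⊆ Y := fun i hi => by simpa [hY] using hC i hi
  have hYC : Y = C ∪ (Y \ C) := (Finset.union_sdiff_of_subset hCY).symm
  have hdis : Disjoint C (Y \ C) := Finset.disjoint_sdiff
  have h0 : pairs G C (Y \ C) = 0 := by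
    refine pairs_eq_zero G fun i hi j hj hadj => ?_
    rw [Finset.mem_sdiff] at hj
    exact hj.2 (hclosed i hi j (by simpa [hY] using hj.1) hadj)
  have hYY : pairs G Y Y = pairs G C C + pairs G (Y \ C) (Y \ C) := by
    conv_lhs => rw [hYC]
    rw [pairs_union_left G hdis, pairs_union_right G _ hdis, pairs_union_right G _ hdis,
      pairs_comm G (Y \ C) C, h0]
    ring
  rw [welfare_eq_pairs, welfare_eq_pairs, hX', hY', ← hX, ← hY, hYY, pairs_union_left G hXC,
    pairs_union_right G _ hXC, pairs_union_right G _ hXC, pairs_comm G X C]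
  ring

end Pairs

/-! ### Broad attacks: local structure of the stable states. -/

section Broad

variable {V : Type*} [Fintype V] [DecidableEq V]

/-- The bonus that the imposters of a target set add to the utility of an agent. -/
noncomputable def bonus (α : ℝ) (S : TargetSet V) (i : V) (c : Choice) : ℝ :=
  (if i ∈ S.sy ∧ c = Choice.y then 1 else 0) + (if i ∈ S.sx ∧ c = Choice.x then 1 + α else 0)

/-- The potential of the coordination game under a broad attack. -/
noncomputable def broadPotential (α : ℝ) (G : SimpleGraph V) (S : TargetSet V)
    (a : V → Choice) : ℝ :=
  welfare α G a / 2 + ∑ i, bonus α S i (a i)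

theorem isPotential_broad (α : ℝ) (G : SimpleGraph V) (S : TargetSet V) :
    IsPotential (perceivedUtility α G S) (broadPotential α G S) := by
  have h := isPotential_utility_add α G (bonus α S)
  intro i a z
  refine Eq.trans ?_ (h i a z)
  simp only [perceivedUtility, bonus]
  ring

theorem stable_broad_eq [Nonempty V] (α : ℝ) (G : SimpleGraph V) (S : TargetSet V) :
    stochasticallyStable (fun _ => Finset.univ) (perceivedUtility α G S) =
      {a | ∀ b, broadPotential α G S b ≤ broadPotential α G S a} := by
  rw [(isPotential_broad α G S).stochasticallyStable_eq fun _ => ⟨Choice.x, Finset.mem_univ _⟩]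
  simp

theorem stable_broad_nonempty [Nonempty V] (α : ℝ) (G : SimpleGraph V) (S : TargetSet V) :
    (stochasticallyStable (fun _ => Finset.univ) (perceivedUtility α G S)).Nonempty :=
  (isPotential_broad α G S).stochasticallyStable_nonempty fun _ => ⟨Choice.x, Finset.mem_univ _⟩

/-- Multiplying by `k` and using $k\alpha>k-1$ gives $(2k-1)c<e+k$ for $c>0$. Strictness between
integers improves this to $e\ge(2k-1)c-(k-1)=kc+(k-1)(c-1)\ge kc$. -/
theorem natCast_mul_le_of_gain {α : ℝ} {k : ℕ} (hk : 1 ≤ k) (hα : ((k : ℝ) - 1) / k < α)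
    {e c : ℕ} (h : (1 + α) * c + α * e ≤ e + 1) : (k : ℝ) * c ≤ e := by
  rcases Nat.eq_zero_or_pos c with rfl | hc
  · simp
  have hk0 : (0 : ℝ) < k := by exact_mod_cast hk
  have hc0 : (0 : ℝ) < c := by exact_mod_cast hc
  have h1 : (k : ℝ) - 1 < α * k := (div_lt_iff₀ hk0).1 hα
  have h2 : ((2 * k - 1 : ℝ)) * c < e + k := by
    have h3 := mul_le_mul_of_nonneg_right h hk0.le
    nlinarith [mul_lt_mul_of_pos_right h1 hc0,
      mul_le_mul_of_nonneg_right h1.le (Nat.cast_nonneg (α := ℝ) e)]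
  have h4 : (2 * (k : ℤ) - 1) * c < e + k := by exact_mod_cast h2
  have h5 : (0 : ℤ) ≤ ((k : ℤ) - 1) * ((c : ℤ) - 1) := by
    apply mul_nonneg <;> omega
  have h6 : (k : ℤ) * c ≤ e := by nlinarith
  exact_mod_cast h6

/-- At a stochastically stable state of a broad attack, every edge between an `x`- and a `y`-agent
is paid for by `k` edges between `y`-agents. -/
theorem pairs_le_of_forall_broadPotential_le {α : ℝ} {k : ℕ} (hk : 1 ≤ k)
    (hα : ((k : ℝ) - 1) / k < α) (G : SimpleGraph V) (S : TargetSet V) {a : V → Choice}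
    (ha : ∀ b, broadPotential α G S b ≤ broadPotential α G S a) :
    2 * k * pairs G {i | a i = Choice.y} {i | a i = Choice.x} ≤
      pairs G {i | a i = Choice.y} {i | a i = Choice.y} := by
  classical
  have hα0 : 0 ≤ α := by
    refine le_trans (div_nonneg ?_ (Nat.cast_nonneg k)) hα.le
    rw [sub_nonneg]
    exact_mod_cast hk
  set X : Finset V := {i | a i = Choice.x} with hX
  set Y : Finset V := {i | a i = Choice.y} with hY
  -- Only the edges between `y`-agents are kept, so the components of `H` that meet `Y` are the
  -- clusters of `y`-agents. The claim is proved per cluster and then summed.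
  let H : SimpleGraph V :=
    { Adj := fun i j => G.Adj i j ∧ a i = Choice.y ∧ a j = Choice.y
      symm := ⟨fun i j h => ⟨h.1.symm, h.2.2, h.2.1⟩⟩
      loopless := ⟨fun i h => G.loopless.irrefl i h.1⟩ }
  have hHG : H ≤ G := fun i j h => h.1
  have hreach : ∀ u w, H.Reachable u w → a u = a w := by
    rintro u w ⟨p⟩
    induction p with
    | nil => rfl
    | cons h _ ih => rw [← ih, h.2.1, h.2.2]
  have hcomp : ∀ c : H.ConnectedComponent,
      0 ≤ ∑ i ∈ Y with H.connectedComponentMk i = c,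
        ((∑ j ∈ Y, if G.Adj i j then 1 else 0) - 2 * k * ∑ j ∈ X, if G.Adj i j then (1 : ℝ) else 0)
      := by
    intro c
    induction c using SimpleGraph.ConnectedComponent.ind with | _ v => ?_
    set C : Finset V := {i ∈ Y | H.connectedComponentMk i = H.connectedComponentMk v} with hCdef
    rw [Finset.sum_sub_distrib, ← Finset.mul_sum, sub_nonneg]
    change 2 * (k : ℝ) * pairs G C X ≤ pairs G C Y
    by_cases hv : a v = Choice.y
    swap
    · have : C = ∅ := by
        rw [Finset.eq_empty_iff_forall_notMem]
        intro i hi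
        simp only [hCdef, hY, Finset.mem_filter, Finset.mem_univ, true_and,
          SimpleGraph.ConnectedComponent.eq] at hi
        exact hv (by rw [← hreach _ _ hi.2, hi.1])
      simp [this, pairs]
    have hCy : ∀ i ∈ C, a i = Choice.y := fun i hi => by
      simpa [hY] using (Finset.mem_filter.1 hi).1
    have hclosed : ∀ i ∈ C, ∀ j, a j = Choice.y → G.Adj i j → j ∈ C := by
      intro i hi j hj hadj
      rw [hCdef, Finset.mem_filter] at hi ⊢
      refine ⟨by simpa [hY] using hj, ?_⟩
      rw [← hi.2]
      have hij : H.Adj i j := ⟨hadj, by simpa [hY] using hi.1, hj⟩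
      exact (SimpleGraph.ConnectedComponent.sound hij.reachable).symm
    have hsupp : (C : Set V) = (H.connectedComponentMk v).supp := by
      ext i
      simp only [hCdef, hY, Finset.coe_filter, Finset.mem_filter, Finset.mem_univ, true_and,
        Set.mem_ofPred_eq, SimpleGraph.ConnectedComponent.mem_supp_iff, and_iff_right_iff_imp,
        SimpleGraph.ConnectedComponent.eq]
      intro h
      rw [hreach _ _ h, hv]
    have hconn : (G.induce (C : Set V)).Connected := by
      rw [hsupp]
      exact (H.connectedComponentMk v).connected_toSimpleGraph.mono
        (SimpleGraph.comap_monotone _ hHG)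
    obtain ⟨e, he, hcard⟩ := exists_pairs_self_eq G C hconn
    obtain ⟨c, hc⟩ := exists_pairs_eq_natCast G C X
    have hYC : pairs G C Y = pairs G C C := by
      have hCY : C ⊆ Y := Finset.filter_subset _ _
      rw [← Finset.union_sdiff_of_subset hCY, pairs_union_right G _ Finset.disjoint_sdiff,
        pairs_eq_zero G (A := C) (B := Y \ C), add_zero]
      intro i hi j hj hadj
      rw [Finset.mem_sdiff] at hj
      exact hj.2 (hclosed i hi j (by simpa [hY] using hj.1) hadj)
    -- An agent of `C` that switches to `x` forfeits at most the bonus 1 of a `y`-imposter.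
    have hbonus : ∑ i, bonus α S i (a i) ≤
        ∑ i, bonus α S i (C.piecewise (fun _ => Choice.x) a i) + C.card := by
      have : (C.card : ℝ) = ∑ i, if i ∈ C then 1 else 0 := by simp
      rw [this, ← Finset.sum_add_distrib]
      refine Finset.sum_le_sum fun i _ => ?_
      by_cases hi : i ∈ C
      · simp only [hi, Finset.piecewise_eq_of_mem, hCy i hi, bonus, if_true]
        simp only [reduceCtorEq, and_false, and_true, if_false]
        split_ifs <;> linarith
      · simp [hi]
    have hflip := ha (C.piecewise (fun _ => Choice.x) a)
    unfold broadPotential at hflip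
    rw [welfare_piecewise α G a hCy hclosed, ← hX, he, hc] at hflip
    have hcard' : (C.card : ℝ) ≤ e + 1 := by exact_mod_cast hcard
    have := natCast_mul_le_of_gain hk hα (e := e) (c := c) (by linarith)
    rw [hYC, he, hc]
    linarith
  have hsum : 0 ≤ ∑ i ∈ Y, ((∑ j ∈ Y, if G.Adj i j then 1 else 0) -
      2 * k * ∑ j ∈ X, if G.Adj i j then (1 : ℝ) else 0) := by
    rw [← Finset.sum_fiberwise Y H.connectedComponentMk]
    exact Finset.sum_nonneg fun c _ => by convert hcomp c
  rw [Finset.sum_sub_distrib, ← Finset.mul_sum, sub_nonneg] at hsum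
  exact hsum

end Broad

/-! ### Values and monotonicity of the worst-case risks. -/

section Value

variable {V : Type*} [Fintype V] [DecidableEq V]

omit [DecidableEq V] in
theorem welfare_const_x (α : ℝ) (G : SimpleGraph V) :
    welfare α G (fun _ => Choice.x) = (1 + α) * pairs G Finset.univ Finset.univ := by
  rw [welfare_eq_pairs]
  simp [pairs]

omit [DecidableEq V] in
theorem sSup_range_welfare {αsys : ℝ} (hsys : 0 ≤ αsys) (G : SimpleGraph V) :
    sSup (Set.range (welfare αsys G)) = (1 + αsys) * pairs G Finset.univ Finset.univ := by
  rw [← welfare_const_x]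
  refine IsGreatest.csSup_eq ⟨⟨_, rfl⟩, ?_⟩
  rintro _ ⟨a, rfl⟩
  refine Finset.sum_le_sum fun i _ => Finset.sum_le_sum fun j _ => ?_
  cases a i <;> cases a j <;> simp only [payoff] <;> linarith

theorem pairs_univ_of_union_eq (G : SimpleGraph V) {A B : Finset V} (h : Disjoint A B)
    (hAB : A ∪ B = Finset.univ) :
    pairs G Finset.univ Finset.univ = pairs G A A + 2 * pairs G A B + pairs G B B := by
  rw [← hAB, pairs_union_left G h, pairs_union_right G _ h, pairs_union_right G _ h,
    pairs_comm G B A]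
  ring

/-- By `pairs_le_of_forall_broadPotential_le`, at a stable state at least the fraction $k/(k+1)$ of
all adjacent pairs is coordinated, each worth at least 1; all agents on `x` give the maximal
welfare. -/
theorem broadRisk_le {αsys α : ℝ} (hsys : 0 < αsys) {k : ℕ} (hk : 1 ≤ k)
    (hα : ((k : ℝ) - 1) / k < α) {G : SimpleGraph V} [Nontrivial V] (hG : G.Connected)
    (S : TargetSet V) : broadRisk αsys α G S ≤ 1 - k / ((k + 1) * (1 + αsys)) := by
  have hD : 0 < pairs G Finset.univ Finset.univ := by
    classical
    obtain ⟨u, v, huv⟩ := exists_pair_ne V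
    obtain ⟨p⟩ := hG.preconnected u v
    have huw : ∃ u w, G.Adj u w := by
      cases p with
      | nil => exact absurd rfl huv
      | cons h _ => exact ⟨_, _, h⟩
    obtain ⟨u, w, huw⟩ := huw
    unfold pairs
    have h01 : ∀ i j, (0 : ℝ) ≤ if G.Adj i j then 1 else 0 := fun i j => by
      split_ifs <;> norm_num
    exact Finset.sum_pos' (fun i _ => Finset.sum_nonneg fun j _ => h01 i j) ⟨u, Finset.mem_univ _,
      Finset.sum_pos' (fun j _ => h01 u j) ⟨w, Finset.mem_univ _, by simp [huw]⟩⟩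
  unfold broadRisk broadEfficiency
  rw [sSup_range_welfare hsys.le]
  refine sub_le_sub_left ?_ _
  rw [div_le_div_iff₀ (by positivity) (by positivity)]
  have key : ∀ w ∈ welfare αsys G '' stochasticallyStable (fun _ => Finset.univ)
      (perceivedUtility α G S), k / (k + 1) * pairs G Finset.univ Finset.univ ≤ w := by
    rintro _ ⟨a, ha, rfl⟩
    rw [stable_broad_eq] at ha
    have h := pairs_le_of_forall_broadPotential_le hk hα G S ha
    have hdis : Disjoint ({i | a i = Choice.y} : Finset V) ({i | a i = Choice.x} : Finset V) := by
      rw [Finset.disjoint_left]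
      intro i hi hi'
      simp only [Finset.mem_filter, Finset.mem_univ, true_and] at hi hi'
      simp [hi] at hi'
    have huniv : (Finset.univ : Finset V) =
        ({i | a i = Choice.y} : Finset V) ∪ ({i | a i = Choice.x} : Finset V) := by
      ext i
      cases hi : a i <;> simp [hi]
    rw [welfare_eq_pairs, pairs_univ_of_union_eq G hdis huniv.symm, div_mul_eq_mul_div,
      div_le_iff₀ (by positivity)]
    have h1 := pairs_nonneg G {i | a i = Choice.x} {i | a i = Choice.x}
    have h2 : (0 : ℝ) ≤ αsys * (k + 1) * pairs G {i | a i = Choice.x} {i | a i = Choice.x} := by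
      positivity
    nlinarith
  have h := le_csInf ((stable_broad_nonempty α G S).image _) key
  rw [div_mul_eq_mul_div, div_le_iff₀ (by positivity)] at h
  nlinarith

theorem welfare_starGraph (α : ℝ) {n : ℕ} (a : Fin (n + 1) → Choice) :
    welfare α (SimpleGraph.starGraph 0) a = 2 * ∑ j : Fin n, payoff α (a 0) (a j.succ) := by
  unfold welfare
  simp only [utility_eq_sum_ite, Fin.sum_univ_succ, SimpleGraph.starGraph_adj]
  simp [Fin.succ_ne_zero, (Fin.succ_ne_zero _).symm, payoff_comm α _ (a 0), two_mul]

/-- The target set on the star that protects the leaf `1` by an `x`-imposter and exposes all other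
agents to `y`-imposters. -/
def leafTarget (k : ℕ) : TargetSet (Fin (k + 2)) where
  sx := {1}
  sy := {1}ᶜ
  disjoint := disjoint_compl_right
  cover := Finset.union_compl _

theorem succ_succ_ne_one {k : ℕ} (j : Fin k) : j.succ.succ ≠ (1 : Fin (k + 2)) := by
  rw [← Fin.succ_zero_eq_one, Ne, Fin.succ_inj]
  exact Fin.succ_ne_zero j

/-- Once the centre's choice is fixed, the leaves contribute independently and can be bounded one by
one. -/
theorem broadPotential_star (α : ℝ) {k : ℕ} (a : Fin (k + 2) → Choice) :
    broadPotential α (SimpleGraph.starGraph 0) (leafTarget k) a =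
      (if a 0 = Choice.y then 1 else 0) + (payoff α (a 0) (a 1) +
        if a 1 = Choice.x then 1 + α else 0) +
      ∑ j : Fin k, (payoff α (a 0) (a j.succ.succ) +
        if a j.succ.succ = Choice.y then 1 else 0) := by
  unfold broadPotential
  rw [welfare_starGraph]
  simp only [Fin.sum_univ_succ, bonus, leafTarget, Finset.mem_compl, Finset.mem_singleton]
  simp only [Fin.succ_zero_eq_one, succ_succ_ne_one, Finset.sum_add_distrib, not_false_eq_true, true_and,
    false_and, if_false, not_true_eq_false, Fin.zero_ne_one]
  simp
  ring

/-- The profile with only leaf `1` on `x` has potential $2k+2+\alpha$. With the centre on `x` the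
best potential is $(k+2)(1+\alpha)$, which is no larger exactly when $\alpha\le k/(k+1)$. -/
theorem le_broadRisk_starGraph {αsys α : ℝ} (hsys : 0 < αsys) (h0 : 0 ≤ α) {k : ℕ}
    (hα : α ≤ (k : ℝ) / (k + 1)) :
    1 - k / ((k + 1) * (1 + αsys)) ≤
      broadRisk αsys α (SimpleGraph.starGraph 0) (leafTarget k) := by
  set G : SimpleGraph (Fin (k + 2)) := SimpleGraph.starGraph 0
  let a : Fin (k + 2) → Choice := fun i => if i = 1 then Choice.x else Choice.y
  have hk1 : α * (k + 1) ≤ k := (le_div_iff₀ (by positivity)).1 hα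
  have hk2 : α ≤ 1 := hα.trans ((div_le_one (by positivity)).2 (by linarith))
  have ha : a ∈ stochasticallyStable (fun _ => Finset.univ)
      (perceivedUtility α G (leafTarget k)) := by
    rw [stable_broad_eq]
    intro b
    have hval : broadPotential α G (leafTarget k) a = 2 * k + 2 + α := by
      rw [broadPotential_star]
      simp [a, succ_succ_ne_one, payoff]
      ring
    rw [hval, broadPotential_star]
    rcases hb : b 0 with _ | _
    · have hsum : ∑ j : Fin k, (payoff α Choice.x (b j.succ.succ) +
          if b j.succ.succ = Choice.y then 1 else 0) ≤ ∑ _j : Fin k, (1 + α) := by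
        refine Finset.sum_le_sum fun j _ => ?_
        cases b j.succ.succ <;> simp [payoff, h0]
      rw [Finset.sum_const, Finset.card_univ, Fintype.card_fin, nsmul_eq_mul] at hsum
      have h1 : (payoff α Choice.x (b 1) + if b 1 = Choice.x then 1 + α else 0) ≤
          2 * (1 + α) := by
        cases b 1 <;> simp [payoff] <;> linarith
      simp only [reduceCtorEq, if_false]
      nlinarith
    · have hsum : ∑ j : Fin k, (payoff α Choice.y (b j.succ.succ) +
          if b j.succ.succ = Choice.y then 1 else 0) ≤ ∑ _j : Fin k, (2 : ℝ) := by
        refine Finset.sum_le_sum fun j _ => ?_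
        cases b j.succ.succ <;> simp [payoff]
        norm_num
      rw [Finset.sum_const, Finset.card_univ, Fintype.card_fin, nsmul_eq_mul] at hsum
      have h1 : (payoff α Choice.y (b 1) + if b 1 = Choice.x then 1 + α else 0) ≤ 1 + α := by
        cases b 1 <;> simp [payoff, h0]
      simp only [if_true]
      linarith
  unfold broadRisk broadEfficiency
  have hDval : sSup (Set.range (welfare αsys G)) = 2 * ((k + 1) * (1 + αsys)) := by
    rw [sSup_range_welfare hsys.le, ← welfare_const_x, welfare_starGraph]
    simp only [payoff, Finset.sum_const, Finset.card_univ, Fintype.card_fin, nsmul_eq_mul]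
    push_cast
    rfl
  have hW : welfare αsys G a = 2 * k := by
    rw [welfare_starGraph, Fin.sum_univ_succ]
    simp [a, succ_succ_ne_one, payoff]
  rw [hDval, ← mul_div_mul_left (k : ℝ) _ two_ne_zero]
  refine sub_le_sub_left (div_le_div_of_nonneg_right ?_ (by positivity)) _
  rw [← hW]
  exact csInf_le (Set.toFinite _).bddBelow (Set.mem_image_of_mem _ ha)

/-- The worst-case broad risk only depends on the interval that contains the gain. -/
theorem worstBroad_eq {αsys α : ℝ} (hsys : 0 < αsys) {k : ℕ} (hk : 1 ≤ k)
    (hα : α ∈ gainInterval k) : worstBroad αsys α = 1 - k / ((k + 1) * (1 + αsys)) := by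
  have h0 : 0 ≤ α := by
    refine le_trans (div_nonneg ?_ (Nat.cast_nonneg k)) hα.1.le
    rw [sub_nonneg]
    exact_mod_cast hk
  have hub : ∀ r ∈ {r | ∃ (N : ℕ) (G : SimpleGraph (Fin N)) (S : TargetSet (Fin N)),
      3 ≤ N ∧ G.Connected ∧ r = broadRisk αsys α G S}, r ≤ 1 - k / ((k + 1) * (1 + αsys)) := by
    rintro _ ⟨N, G, S, hN, hG, rfl⟩
    have : Nontrivial (Fin N) := Fin.nontrivial_iff_two_le.2 (by omega)
    exact broadRisk_le hsys hk hα.1 hG S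
  have hmem : broadRisk αsys α (SimpleGraph.starGraph 0) (leafTarget k) ∈
      {r | ∃ (N : ℕ) (G : SimpleGraph (Fin N)) (S : TargetSet (Fin N)),
        3 ≤ N ∧ G.Connected ∧ r = broadRisk αsys α G S} :=
    -- `1 ≤ k` gives the star the required three agents.
    ⟨k + 2, _, leafTarget k, by omega, SimpleGraph.connected_starGraph 0, rfl⟩
  exact le_antisymm (csSup_le ⟨_, hmem⟩ hub)
    ((le_broadRisk_starGraph hsys h0 hα.2).trans (le_csSup ⟨_, hub⟩ hmem))

theorem worstBroad_le_one {αsys α : ℝ} (hsys : 0 < αsys) {k : ℕ} (hk : 1 ≤ k)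
    (hα : α ∈ gainInterval k) : worstBroad αsys α ≤ 1 := by
  rw [worstBroad_eq hsys hk hα]
  have : (0 : ℝ) ≤ k / ((k + 1) * (1 + αsys)) := by positivity
  linarith

theorem worstBroad_nonneg {αsys α : ℝ} (hsys : 0 < αsys) {k : ℕ} (hk : 1 ≤ k)
    (hα : α ∈ gainInterval k) : 0 ≤ worstBroad αsys α := by
  rw [worstBroad_eq hsys hk hα, sub_nonneg]
  refine div_le_one_of_le₀ ?_ (by positivity)
  have : (0 : ℝ) ≤ k * αsys := by positivity
  nlinarith

theorem one_mem_upperBounds_focusedRisk {αsys : ℝ} (hsys : 0 < αsys) (α : ℝ) :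
    1 ∈ upperBounds {r | ∃ (N : ℕ) (G : SimpleGraph (Fin N)) (F : FixedSet (Fin N)),
      3 ≤ N ∧ G.Connected ∧ r = focusedRisk αsys α G F} := by
  rintro _ ⟨N, G, F, -, -, rfl⟩
  exact (focusedRisk_mem_Icc hsys α G F).2

theorem worstFocused_le_one {αsys : ℝ} (hsys : 0 < αsys) (α : ℝ) :
    worstFocused αsys α ≤ 1 :=
  Real.sSup_le (one_mem_upperBounds_focusedRisk hsys α) zero_le_one

theorem worstFocused_nonneg {αsys : ℝ} (hsys : 0 < αsys) (α : ℝ) :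
    0 ≤ worstFocused αsys α := by
  refine Real.sSup_nonneg ?_
  rintro _ ⟨N, G, F, -, -, rfl⟩
  exact (focusedRisk_mem_Icc hsys α G F).1

theorem worstFocused_mono {αsys α α' : ℝ} (hsys : 0 < αsys) (hge : αsys ≤ α') (hlt : α' < α) :
    worstFocused αsys α' ≤ worstFocused αsys α := by
  refine Real.sSup_le ?_ (worstFocused_nonneg hsys α)
  rintro _ ⟨N, G, F, hN, hG, rfl⟩
  have : Nonempty (Fin N) := ⟨⟨0, by omega⟩⟩
  exact (focusedRisk_mono hsys hge hlt G F).trans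
    (le_csSup ⟨1, one_mem_upperBounds_focusedRisk hsys α⟩ ⟨N, G, F, hN, hG, rfl⟩)

end Value

/-! ### Attainment and monotonicity for the linear programs. -/

section LP

variable {M : ℕ}

theorem mem_lpValues_iff {A B : Matrix (Fin M) (Fin M) ℝ} {γ v : ℝ} :
    v ∈ lpValues A B γ ↔ v ∈ Set.Icc (0 : ℝ) 1 ∧ ∃ p ∈ stdSimplex ℝ (Fin M),
      (∀ i, A.mulVec p i ≤ v) ∧ ∀ i, B.mulVec p i ≤ γ := by
  unfold lpValues
  simp only [Matrix.fromBlocks_mulVec, Set.mem_ofPred_eq]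
  refine and_congr_right fun _ => exists_congr fun p => and_congr_right fun _ => ?_
  simp [Pi.le_def, Matrix.mulVec, dotProduct]

/-- The value 1 is feasible because the entries of `A` are at most 1 and `p` sums to 1; the set of
values is the projection of a compact set. -/
theorem isLeast_lpValues {A B : Matrix (Fin M) (Fin M) ℝ} {γ : ℝ} (hA : ∀ i j, A i j ≤ 1)
    {p : Fin M → ℝ} (hp : p ∈ stdSimplex ℝ (Fin M)) (hB : ∀ i, B.mulVec p i ≤ γ) :
    IsLeast (lpValues A B γ) (sInf (lpValues A B γ)) := by
  have hne : (lpValues A B γ).Nonempty := by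
    refine ⟨1, mem_lpValues_iff.2 ⟨by simp, p, hp, fun i => ?_, hB⟩⟩
    rw [← hp.2]
    change ∑ j, A i j * p j ≤ _
    exact Finset.sum_le_sum fun j _ => mul_le_of_le_one_left (hp.1 j) (hA i j)
  have hcompact : IsCompact (lpValues A B γ) := by
    have heq : lpValues A B γ = Prod.fst '' ((Set.Icc (0 : ℝ) 1 ×ˢ stdSimplex ℝ (Fin M)) ∩
        {q : ℝ × (Fin M → ℝ) | (∀ i, A.mulVec q.2 i ≤ q.1) ∧ ∀ i, B.mulVec q.2 i ≤ γ}) := by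
      ext v
      rw [mem_lpValues_iff]
      constructor
      · rintro ⟨hv, p, hp, h⟩
        exact ⟨(v, p), ⟨⟨hv, hp⟩, h⟩, rfl⟩
      · rintro ⟨⟨v, p⟩, ⟨⟨hv, hp⟩, h⟩, rfl⟩
        exact ⟨hv, p, hp, h⟩
    rw [heq]
    refine ((isCompact_Icc.prod (isCompact_stdSimplex ℝ (Fin M))).inter_right ?_).image
      continuous_fst
    have hcont : ∀ (C : Matrix (Fin M) (Fin M) ℝ) i,
        Continuous fun q : ℝ × (Fin M → ℝ) => C.mulVec q.2 i := fun C i =>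
      (continuous_apply i).comp (continuous_const.matrix_mulVec continuous_snd)
    refine IsClosed.and ?_ ?_
    · simp only [Set.ofPred_forall]
      exact isClosed_iInter fun i => isClosed_le (hcont A i) continuous_fst
    · simp only [Set.ofPred_forall]
      exact isClosed_iInter fun i => isClosed_le (hcont B i) continuous_const
  exact hcompact.isLeast_sInf hne

theorem mulVec_le_mulVec {A A' : Matrix (Fin M) (Fin M) ℝ} (hA : ∀ i j, A' i j ≤ A i j)
    {p : Fin M → ℝ} (hp : ∀ j, 0 ≤ p j) (i : Fin M) : A'.mulVec p i ≤ A.mulVec p i := by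
  change ∑ j, A' i j * p j ≤ ∑ j, A i j * p j
  exact Finset.sum_le_sum fun j _ => mul_le_mul_of_nonneg_right (hA i j) (hp j)

theorem lpValues_subset {A B A' B' : Matrix (Fin M) (Fin M) ℝ} (γ : ℝ)
    (hA : ∀ i j, A' i j ≤ A i j) (hB : ∀ i j, B' i j ≤ B i j) :
    lpValues A B γ ⊆ lpValues A' B' γ := by
  intro v
  rw [mem_lpValues_iff, mem_lpValues_iff]
  rintro ⟨hv, p, hp, h1, h2⟩
  exact ⟨hv, p, hp, fun i => (mulVec_le_mulVec hA hp.1 i).trans (h1 i),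
    fun i => (mulVec_le_mulVec hB hp.1 i).trans (h2 i)⟩

end LP

/-! ### Feasibility for the gain matrices. -/

section Gains

variable {αsys : ℝ} {M : ℕ} {α : Fin (M + 1) → ℝ} {γ : ℝ}

/-- The point mass on the last gain is feasible: the only possibly nonzero entry in the last column
of `matBroad` is the diagonal one. The zero entries require `0 ≤ γ`. -/
theorem isLeast_vFocused (hsys : 0 < αsys) (h0 : 0 ≤ γ)
    (hγ : worstBroad αsys (α (Fin.last M)) ≤ γ) :
    IsLeast (focusedValues αsys γ α) (vFocused αsys γ α) := by
  refine isLeast_lpValues (fun i j => ?_) (single_mem_stdSimplex ℝ (Fin.last M)) fun i => ?_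
  · unfold matFocused
    rw [Matrix.of_apply]
    split_ifs
    · exact worstFocused_le_one hsys _
    · exact zero_le_one
  · rw [Matrix.mulVec_single_one, Matrix.col_apply]
    unfold matBroad
    rw [Matrix.of_apply]
    split_ifs with hi
    · rwa [Fin.last_le_iff.1 hi]
    · exact h0

/-- Here the point mass on the first gain is feasible, the matrix being upper triangular. -/
theorem isLeast_vBroad (hα : ∀ i, worstBroad αsys (α i) ≤ 1) (h0 : 0 ≤ γ)
    (hγ : worstFocused αsys (α 0) ≤ γ) :
    IsLeast (broadValues αsys γ α) (vBroad αsys γ α) := by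
  refine isLeast_lpValues (fun i j => ?_) (single_mem_stdSimplex ℝ (0 : Fin (M + 1))) fun i => ?_
  · unfold matBroad
    rw [Matrix.of_apply]
    split_ifs
    · exact hα i
    · exact zero_le_one
  · rw [Matrix.mulVec_single_one, Matrix.col_apply]
    unfold matFocused
    rw [Matrix.of_apply]
    split_ifs with hi
    · rwa [Fin.le_zero_iff.1 hi]
    · exact h0

theorem matBroad_congr {α' : Fin (M + 1) → ℝ}
    (h : ∀ i, worstBroad αsys (α' i) = worstBroad αsys (α i)) :
    matBroad αsys α' = matBroad αsys α := by
  unfold matBroad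
  simp only [h]

theorem matFocused_mono {α' : Fin (M + 1) → ℝ}
    (h : ∀ i, worstFocused αsys (α' i) ≤ worstFocused αsys (α i)) (i j : Fin (M + 1)) :
    matFocused αsys α' i j ≤ matFocused αsys α i j := by
  unfold matFocused
  rw [Matrix.of_apply, Matrix.of_apply]
  split_ifs
  · exact h i
  · exact le_rfl

end Gains

end CoordGame

theorem claim1 (αsys : ℝ) (hsys : 0 < αsys) (M : ℕ) (α α' : Fin (M + 1) → ℝ)
    (hα : StrictMono α) (k : Fin (M + 1) → ℕ) (hk : ∀ j, 1 ≤ k j) (hk_mono : Monotone k)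
    (hαk : ∀ j, α j ∈ CoordGame.gainInterval (k j))
    (hαk' : ∀ j, α' j ∈ CoordGame.gainInterval (k j))
    (hlt : ∀ j, α' j < α j)
    (hge : ∀ j, αsys ≤ α' j) :
    (∀ γb ∈ Set.Icc (CoordGame.worstBroad αsys (α (Fin.last M))) 1,
      IsLeast (CoordGame.focusedValues αsys γb α) (CoordGame.vFocused αsys γb α) ∧
      IsLeast (CoordGame.focusedValues αsys γb α') (CoordGame.vFocused αsys γb α') ∧
      CoordGame.vFocused αsys γb α' ≤ CoordGame.vFocused αsys γb α) ∧
    (∀ γf ∈ Set.Icc (CoordGame.worstFocused αsys (α 0)) 1,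
      IsLeast (CoordGame.broadValues αsys γf α) (CoordGame.vBroad αsys γf α) ∧
      IsLeast (CoordGame.broadValues αsys γf α') (CoordGame.vBroad αsys γf α') ∧
      CoordGame.vBroad αsys γf α' ≤ CoordGame.vBroad αsys γf α) ∧
    (∀ q ∈ CoordGame.frontier αsys α, ∃ q' ∈ CoordGame.frontier αsys α', q' ≤ q) := by
  open CoordGame in
  have hbroad : ∀ j, worstBroad αsys (α' j) = worstBroad αsys (α j) := fun j => by
    rw [worstBroad_eq hsys (hk j) (hαk j), worstBroad_eq hsys (hk j) (hαk' j)]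
  have hbroad1 : ∀ j, worstBroad αsys (α j) ≤ 1 := fun j =>
    worstBroad_le_one hsys (hk j) (hαk j)
  have hbroad0 : ∀ j, 0 ≤ worstBroad αsys (α j) := fun j =>
    worstBroad_nonneg hsys (hk j) (hαk j)
  have hfocused : ∀ j, worstFocused αsys (α' j) ≤ worstFocused αsys (α j) := fun j =>
    worstFocused_mono hsys (hge j) (hlt j)
  have hmb := matBroad_congr hbroad
  have hmf := matFocused_mono hfocused
  have part1 : ∀ γb ∈ Set.Icc (worstBroad αsys (α (Fin.last M))) 1,
      IsLeast (focusedValues αsys γb α) (vFocused αsys γb α) ∧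
      IsLeast (focusedValues αsys γb α') (vFocused αsys γb α') ∧
      vFocused αsys γb α' ≤ vFocused αsys γb α := by
    intro γ hγ
    have h0 : 0 ≤ γ := (hbroad0 _).trans hγ.1
    have h1 := isLeast_vFocused hsys h0 hγ.1
    have h2 := isLeast_vFocused (α := α') hsys h0 ((hbroad _).trans_le hγ.1)
    exact ⟨h1, h2, h2.2 (lpValues_subset γ hmf (fun i j => by rw [hmb]) h1.1)⟩
  refine ⟨part1, fun γ hγ => ?_, ?_⟩
  · have h0 : 0 ≤ γ := (worstFocused_nonneg hsys _).trans hγ.1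
    have h1 := isLeast_vBroad hbroad1 h0 hγ.1
    have h2 := isLeast_vBroad (α := α') (fun i => (hbroad i).trans_le (hbroad1 i)) h0
      ((hfocused 0).trans hγ.1)
    exact ⟨h1, h2, h2.2 (lpValues_subset γ (fun i j => by rw [hmb]) hmf h1.1)⟩
  · rintro _ ⟨γ, hγ, rfl⟩
    -- The level `γ` itself serves for `α'`: both frontiers run over the same interval, since the
    -- broad risks agree.
    refine ⟨_, ⟨γ, ?_, rfl⟩, (part1 γ ⟨hγ.1, hγ.2.trans (hbroad1 0)⟩).2.2, le_rfl⟩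
    rw [hbroad, hbroad]
    exact hγ
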